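/- Let $m\ge 4$. A piece is a triple $(h,k,s)$ with height $h\in\{1,2,\dots\}$, column $k\in\mathbb Z/m\mathbb Z$ and sign $s\in\{+,-\}$. For a finite set $H$ of pieces let $h_k$ denote the height of the highest piece of $H$ in column $k$, with $h_k=0$ if column $k$ is empty. Dropping a piece of column $k$ and sign $s$ on $H$ means the following: if $h_k>\max\{h_{k-1},h_{k+1}\}$ and the highest piece in column $k$ has sign different from $s$, then that piece is deleted from $H$ (the two pieces annihilate); otherwise the piece $(\max\{h_{k-1},h_k,h_{k+1}\}+1,\,k,\,s)$ is added to $H$. Let $W_0=\emptyset$ and let $W_n$ be obtained from $W_{n-1}$ by dropping a piece whose column and sign are chosen uniformly among the $2m$ possibilities, independently of all previous choices. (This is the heap model of the simple random walk, started at the identity, on the locally free group $\langle g_0,\dots,g_{m-1} : g_ig_j=g_jg_i \text{ whenever } i\not\equiv j\pm1 \pmod m\rangle$.) Let $T(W_n)$ be the roof of $W_n$, i.e. the set of those pieces of $W_n$ above which there is no piece of $W_n$ in their own column or in the two adjacent columns. Then, almost surely, $$\limsup_{n\to\infty}\ \frac{1}{mn}\sum_{k=1}^{n}\#T(W_k)\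 \le\ 0.32893 .$$ -/

import Mathlib

open MeasureTheory ProbabilityTheory Filter

namespace RandomHeap

/-- A signed piece over the columns `ℤ/mℤ`: its height (at least `1` in a heap), its column, and
its sign (`true` for `+`, `false` for `-`). -/
@[ext]
structure Piece (m : ℕ) where
  height : ℕ
  col : ZMod m
  sign : Bool
  deriving DecidableEq

/-- The height `h_k` of the highest piece in column `k` of `H`, and `0` if there is none. -/
def colHeight {m : ℕ} (H : Finset (Piece m)) (k : ZMod m) : ℕ :=
  (H.filter (fun p => p.col = k)).sup Piece.height

/-- Drop a piece with column and sign `x = (k, s)` on `H`. If the highest piece of column `k` lies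
strictly above everything in the columns `k - 1` and `k + 1` and has the opposite sign, both pieces
annihilate; otherwise the new piece is added at height `max (h_{k-1}, h_k, h_{k+1}) + 1`. -/
def drop {m : ℕ} (H : Finset (Piece m)) (x : ZMod m × Bool) : Finset (Piece m) :=
  if max (colHeight H (x.1 - 1)) (colHeight H (x.1 + 1)) < colHeight H x.1 ∧
      (⟨colHeight H x.1, x.1, !x.2⟩ : Piece m) ∈ H then
    H.erase ⟨colHeight H x.1, x.1, !x.2⟩
  else
    insert ⟨max (max (colHeight H (x.1 - 1)) (colHeight H x.1)) (colHeight H (x.1 + 1)) + 1,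
      x.1, x.2⟩ H

/-- The roof `T(H)`: the removable pieces, those with no piece lying above them in their own column
or in the two adjacent columns. -/
def roof {m : ℕ} (H : Finset (Piece m)) : Finset (Piece m) :=
  H.filter (fun p => ∀ q ∈ H,
    q.col = p.col - 1 ∨ q.col = p.col ∨ q.col = p.col + 1 → ¬ p.height < q.height)

/-- The heap `W_n` after dropping, in this order, the `n` pieces `x 0, …, x (n - 1)` on the empty
heap. -/
def heapProcess {m : ℕ} (x : ℕ → ZMod m × Bool) : ℕ → Finset (Piece m)
  | 0 => ∅
  | n + 1 => drop (heapProcess x n) (x n)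

end RandomHeap

/-! The proof is a Lyapunov argument. A heap receives an integer potential that depends only on the
heights `h` of the top pieces and `g` of the second pieces. It is a weighted count of roof pieces
and of local patterns recording what the removal of a roof piece would expose. Off the roof both
signs add a piece; on a roof column one sign adds and the other annihilates. The change of the
potential is bounded by patterns near the column hit (`potential_put_sub_le`,
`potential_remove_sub_le`). Third heights are not tracked, so after a removal the new second height
is arbitrary and the newly exposed pieces are charged their worst possible weight
(`exposed_weight_le`).

The weights 270, 60, 48, 12, -6, -1 are chosen so that, summed over all `2m` drops, every pattern
except the roof pieces cancels (`sum_bounds`). The total change is then at most `2 (270 m - 821 #T)`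
(`sum_heapPotential_drop_le`).

Summed over time, the potential telescopes to a bounded quantity. The deviations from the mean drift
are bounded martingale differences, negligible by a strong law (`ae_tendsto_incSum_div`). This
leaves the limsup at most 270/821 = 0.328867.... -/

namespace RandomHeap

/-- The integer indicator of a proposition. -/
def ind (p : Prop) [Decidable p] : ℤ := if p then 1 else 0

theorem ind_nonneg (p : Prop) [Decidable p] : 0 ≤ ind p := by unfold ind; split_ifs <;> simp

theorem ind_le_one (p : Prop) [Decidable p] : ind p ≤ 1 := by unfold ind; split_ifs <;> simp

theorem ind_add_le {p q r : Prop} [Decidable p] [Decidable q] [Decidable r] (hp : p → r)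
    (hq : q → r) (hpq : p → ¬ q) : ind p + ind q ≤ ind r := by
  unfold ind; split_ifs <;> first | omega | (exfalso; tauto)

/-! ### Local patterns in a height profile, and arithmetic of nearby columns -/

section Profile

variable {m : ℕ}

/-- Column `k` carries a roof piece. -/
def IsPeak (h : ZMod m → ℕ) (k : ZMod m) : Prop := h (k - 1) < h k ∧ h (k + 1) < h k

/-- The roof piece of column `k` directly covers the second piece of its own column. -/
def CoversSelf (h g : ZMod m → ℕ) (k : ZMod m) : Prop :=
  IsPeak h k ∧ h (k - 1) < g k ∧ h (k + 1) < g k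

/-- Removing the roof piece of column `k` puts column `k + 1` into the roof. -/
def CoversRight (h g : ZMod m → ℕ) (k : ZMod m) : Prop :=
  IsPeak h k ∧ g k < h (k + 1) ∧ h (k + 2) < h (k + 1)

/-- Removing the roof piece of column `k` puts column `k - 1` into the roof. -/
def CoversLeft (h g : ZMod m → ℕ) (k : ZMod m) : Prop :=
  IsPeak h k ∧ g k < h (k - 1) ∧ h (k - 2) < h (k - 1)

/-- Both neighbours of column `c` are in the roof. -/
def PeakPair (h : ZMod m → ℕ) (c : ZMod m) : Prop := IsPeak h (c - 1) ∧ IsPeak h (c + 1)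

/-- Both neighbours of column `c` are in the roof, and column `c` joins the roof as soon as
both are removed. -/
def Held (h g : ZMod m → ℕ) (c : ZMod m) : Prop :=
  PeakPair h c ∧ g (c - 1) < h c ∧ g (c + 1) < h c

/-- Removing the roof piece of column `k` exposes both adjacent columns. -/
def CoversBoth (h g : ZMod m → ℕ) (k : ZMod m) : Prop := CoversLeft h g k ∧ CoversRight h g k

instance (h : ZMod m → ℕ) (k : ZMod m) : Decidable (IsPeak h k) := by
  unfold IsPeak; infer_instance
instance (h g : ZMod m → ℕ) (k : ZMod m) : Decidable (CoversSelf h g k) := by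
  unfold CoversSelf; infer_instance
instance (h g : ZMod m → ℕ) (k : ZMod m) : Decidable (CoversRight h g k) := by
  unfold CoversRight; infer_instance
instance (h g : ZMod m → ℕ) (k : ZMod m) : Decidable (CoversLeft h g k) := by
  unfold CoversLeft; infer_instance
instance (h : ZMod m → ℕ) (k : ZMod m) : Decidable (PeakPair h k) := by
  unfold PeakPair; infer_instance
instance (h g : ZMod m → ℕ) (k : ZMod m) : Decidable (Held h g k) := by
  unfold Held; infer_instance
instance (h g : ZMod m → ℕ) (k : ZMod m) : Decidable (CoversBoth h g k) := by
  unfold CoversBoth; infer_instance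

theorem one_two_three_ne_zero (hm : 4 ≤ m) : (1 : ZMod m) ≠ 0 ∧ (2 : ZMod m) ≠ 0 ∧ (3 : ZMod m) ≠ 0 := by
  have key : ∀ n : ℕ, 0 < n → n < 4 → (n : ZMod m) ≠ 0 := fun n h0 h4 h => by
    rw [ZMod.natCast_eq_zero_iff] at h
    exact absurd (Nat.le_of_dvd h0 h) (by omega)
  exact ⟨by simpa using key 1, by simpa using key 2, by simpa using key 3⟩

/-- Normal forms of sums of small offsets. -/
theorem offset_nf (a : ZMod m) :
    a + 1 - 1 = a ∧ a - 1 + 1 = a ∧ a + 1 + 1 = a + 2 ∧ a - 1 - 1 = a - 2 ∧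
    a + 2 - 1 = a + 1 ∧ a - 2 + 1 = a - 1 ∧ a + 2 - 2 = a ∧ a - 2 + 2 = a ∧
    a + 1 - 2 = a - 1 ∧ a - 1 + 2 = a + 1 ∧ a + 1 + 2 = a + 3 ∧ a - 1 - 2 = a - 3 ∧
    a + 2 + 1 = a + 3 ∧ a - 2 - 1 = a - 3 := by
  refine ⟨?_, ?_, ?_, ?_, ?_, ?_, ?_, ?_, ?_, ?_, ?_, ?_, ?_, ?_⟩ <;> ring

/-- Columns whose offsets differ by at most three are distinct. -/
theorem offset_ne (hm : 4 ≤ m) (a : ZMod m) :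
    ((a = a + 1 ↔ False) ∧ (a = a - 1 ↔ False) ∧ (a = a + 2 ↔ False) ∧ (a = a - 2 ↔ False) ∧
    (a = a + 3 ↔ False) ∧ (a = a - 3 ↔ False)) ∧
    ((a + 1 = a ↔ False) ∧ (a - 1 = a ↔ False) ∧ (a + 2 = a ↔ False) ∧ (a - 2 = a ↔ False)) ∧
    ((a + 1 = a - 1 ↔ False) ∧ (a - 1 = a + 1 ↔ False) ∧ (a + 2 = a + 1 ↔ False) ∧
    (a + 1 = a + 2 ↔ False) ∧ (a - 2 = a - 1 ↔ False) ∧ (a - 1 = a - 2 ↔ False)) ∧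
    ((a + 2 = a - 1 ↔ False) ∧ (a - 1 = a + 2 ↔ False) ∧ (a - 2 = a + 1 ↔ False) ∧
    (a + 1 = a - 2 ↔ False)) := by
  obtain ⟨h1, h2, h3⟩ := one_two_three_ne_zero hm
  simp only [iff_false]
  refine ⟨⟨?_, ?_, ?_, ?_, ?_, ?_⟩, ⟨?_, ?_, ?_, ?_⟩, ⟨?_, ?_, ?_, ?_, ?_, ?_⟩, ?_, ?_, ?_, ?_⟩ <;>
  intro h <;>
  first
  | exact h1 (by linear_combination h)
  | exact h1 (by linear_combination -h)
  | exact h2 (by linear_combination h)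
  | exact h2 (by linear_combination -h)
  | exact h3 (by linear_combination h)
  | exact h3 (by linear_combination -h)

theorem offset_cases (k j : ZMod m) :
    k = j ∨ k = j - 1 ∨ k = j + 1 ∨ k = j - 2 ∨ k = j + 2 ∨
    (j ≠ k ∧ j + 1 ≠ k ∧ j - 1 ≠ k ∧ j + 2 ≠ k ∧ j - 2 ≠ k ∧
      j ≠ k + 1 ∧ j ≠ k - 1 ∧ j ≠ k + 2 ∧ j ≠ k - 2) := by
  by_cases h0 : k = j
  · exact .inl h0
  by_cases h1 : k = j - 1
  · exact .inr (.inl h1)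
  by_cases h2 : k = j + 1
  · exact .inr (.inr (.inl h2))
  by_cases h3 : k = j - 2
  · exact .inr (.inr (.inr (.inl h3)))
  by_cases h4 : k = j + 2
  · exact .inr (.inr (.inr (.inr (.inl h4))))
  refine .inr (.inr (.inr (.inr (.inr ⟨Ne.symm h0, Ne.symm h2, Ne.symm h1, Ne.symm h4, Ne.symm h3,
    ?_, ?_, ?_, ?_⟩))))
  · rintro rfl; exact h1 (by ring)
  · rintro rfl; exact h2 (by ring)
  · rintro rfl; exact h3 (by ring)
  · rintro rfl; exact h4 (by ring)

/-- For `m = 4` the columns `j + 2` and `j - 2` coincide, for larger `m` they do not; the pattern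
estimates treat both cases by splitting here. -/
theorem offset_four (j : ZMod m) :
    (j + 2 = j - 2 ∧ j - 3 = j + 1 ∧ j + 3 = j - 1 ∧ j - 2 - 2 = j ∧ j + 2 + 2 = j) ∨
    ((j + 2 = j - 2 ↔ False) ∧ (j - 2 = j + 2 ↔ False) ∧ (j = j - 2 - 2 ↔ False) ∧
      (j = j + 2 + 2 ↔ False)) := by
  by_cases h : (4 : ZMod m) = 0
  · left
    refine ⟨?_, ?_, ?_, ?_, ?_⟩ <;>
    first
    | linear_combination h
    | linear_combination -h
  · right
    simp only [iff_false]
    refine ⟨?_, ?_, ?_, ?_⟩ <;> intro h' <;> apply h <;>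
    first
    | linear_combination h'
    | linear_combination -h'

end Profile

/-! ### Effect of an added piece on each pattern -/

section Put
variable {m : ℕ}

/-- The column heights after column `k` is given the height `M`. -/
abbrev put (h : ZMod m → ℕ) (k : ZMod m) (M : ℕ) : ZMod m → ℕ := Function.update h k M

/-- The new piece enters the roof and covers columns `k` and `k ± 1`. As in the companion estimates,
the claim is made column by column, with guards `j = a`, so that summing over `j` yields the change
of the count. Subtractions are moved across the inequality. -/
theorem ind_isPeak_put_le (hm : 4 ≤ m) (h : ZMod m → ℕ) (k : ZMod m) (M : ℕ)
    (h0 : h k < M) (hl : h (k - 1) < M) (hr : h (k + 1) < M) (j : ZMod m) :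
    ind (IsPeak (put h k M) j) + ind (j = k ∧ IsPeak h j) + ind (j = k + 1 ∧ IsPeak h j) +
      ind (j = k - 1 ∧ IsPeak h j) ≤ ind (IsPeak h j) + ind (j = k) := by
  rcases offset_cases k j with rfl | rfl | rfl | rfl | rfl | e <;>
  simp only [offset_nf, offset_ne hm, IsPeak, put, Function.update_apply,
    ind, true_and, false_and, if_true, if_false, *] at * <;>
  split_ifs <;> omega

theorem ind_coversSelf_put_le (hm : 4 ≤ m) (h g : ZMod m → ℕ) (k : ZMod m) (M : ℕ)
    (h0 : h k < M) (hl : h (k - 1) < M) (hr : h (k + 1) < M) (j : ZMod m) :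
    ind (CoversSelf (put h k M) (put g k (h k)) j) + ind (j = k ∧ CoversSelf h g j) +
      ind (j = k + 1 ∧ CoversSelf h g j) + ind (j = k - 1 ∧ CoversSelf h g j) ≤
      ind (CoversSelf h g j) + ind (j = k ∧ IsPeak h j) := by
  rcases offset_cases k j with rfl | rfl | rfl | rfl | rfl | e <;>
  simp only [offset_nf, offset_ne hm, IsPeak, CoversSelf, put, Function.update_apply,
    ind, true_and, false_and, if_true, if_false, *] at * <;>
  split_ifs <;> omega

theorem ind_coversRight_put_le (hm : 4 ≤ m) (h g : ZMod m → ℕ) (k : ZMod m) (M : ℕ)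
    (h0 : h k < M) (hl : h (k - 1) < M) (hr : h (k + 1) < M) (j : ZMod m) :
    ind (CoversRight (put h k M) (put g k (h k)) j) + ind (j = k ∧ CoversRight h g j) +
      ind (j = k + 1 ∧ CoversRight h g j) + ind (j = k - 1 ∧ CoversRight h g j) +
      ind (j = k - 2 ∧ CoversRight h g j) ≤
      ind (CoversRight h g j) + ind (j = k ∧ IsPeak h (j + 1)) := by
  rcases offset_four j with q | q <;>
  rcases offset_cases k j with rfl | rfl | rfl | rfl | rfl | e <;>
  simp only [offset_nf, offset_ne hm, IsPeak, CoversRight, put, Function.update_apply,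
    ind, true_and, false_and, if_true, if_false, *] at * <;>
  split_ifs <;> omega

theorem ind_coversLeft_put_le (hm : 4 ≤ m) (h g : ZMod m → ℕ) (k : ZMod m) (M : ℕ)
    (h0 : h k < M) (hl : h (k - 1) < M) (hr : h (k + 1) < M) (j : ZMod m) :
    ind (CoversLeft (put h k M) (put g k (h k)) j) + ind (j = k ∧ CoversLeft h g j) +
      ind (j = k + 1 ∧ CoversLeft h g j) + ind (j = k - 1 ∧ CoversLeft h g j) +
      ind (j = k + 2 ∧ CoversLeft h g j) ≤
      ind (CoversLeft h g j) + ind (j = k ∧ IsPeak h (j - 1)) := by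
  rcases offset_four j with q | q <;>
  rcases offset_cases k j with rfl | rfl | rfl | rfl | rfl | e <;>
  simp only [offset_nf, offset_ne hm, IsPeak, CoversLeft, put, Function.update_apply,
    ind, true_and, false_and, if_true, if_false, *] at * <;>
  split_ifs <;> omega

/-- If the roof piece of `k + 2` would expose `k + 1`, the new piece at `k` blocks this, and column
`k + 1` becomes held by `k` and `k + 2`; the mirror case is the same. This is how part of the weight
lost with a covering pattern is recovered. -/
theorem ind_held_put_le (hm : 4 ≤ m) (h g : ZMod m → ℕ) (k : ZMod m) (M : ℕ)
    (h0 : h k < M) (hl : h (k - 1) < M) (hr : h (k + 1) < M) (j : ZMod m) :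
    ind (Held (put h k M) (put g k (h k)) j) + ind (j = k ∧ Held h g j) +
      ind (j = k + 1 ∧ Held h g j) + ind (j = k - 1 ∧ Held h g j) + ind (j = k + 2 ∧ Held h g j) ≤
      ind (Held h g j) + ind (j = k + 1 ∧ CoversLeft h g (j + 1)) +
        ind (j = k - 1 ∧ CoversRight h g (j - 1)) := by
  rcases offset_four j with q | q <;>
  rcases offset_cases k j with rfl | rfl | rfl | rfl | rfl | e <;>
  simp only [offset_nf, offset_ne hm, IsPeak, PeakPair, Held, CoversLeft, CoversRight, put, Function.update_apply,
    ind, true_and, false_and, if_true, if_false, *] at * <;>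
  split_ifs <;> omega

/-- This pattern and `PeakPair` have negative weight, so their counts are bounded from below. -/
theorem ind_coversBoth_le_put (hm : 4 ≤ m) (h g : ZMod m → ℕ) (k : ZMod m) (M : ℕ)
    (h0 : h k < M) (hl : h (k - 1) < M) (hr : h (k + 1) < M) (j : ZMod m) :
    ind (CoversBoth h g j) + ind (j = k ∧ PeakPair h j) ≤
      ind (CoversBoth (put h k M) (put g k (h k)) j) + ind (j = k ∧ CoversBoth h g j) +
        ind (j = k + 1 ∧ CoversBoth h g j) + ind (j = k - 1 ∧ CoversBoth h g j) +
        ind (j = k + 2 ∧ CoversBoth h g j) + ind (j = k - 2 ∧ CoversBoth h g j) := by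
  rcases offset_four j with q | q <;>
  rcases offset_cases k j with rfl | rfl | rfl | rfl | rfl | e <;>
  simp only [offset_nf, offset_ne hm, IsPeak, PeakPair, CoversBoth, CoversLeft, CoversRight, put, Function.update_apply,
    ind, true_and, false_and, if_true, if_false, *] at * <;>
  split_ifs <;> omega

theorem ind_peakPair_le_put (hm : 4 ≤ m) (h : ZMod m → ℕ) (k : ZMod m) (M : ℕ)
    (h0 : h k < M) (hl : h (k - 1) < M) (hr : h (k + 1) < M) (j : ZMod m) :
    ind (PeakPair h j) + ind (j = k + 1 ∧ IsPeak h (j + 1)) + ind (j = k - 1 ∧ IsPeak h (j - 1)) ≤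
      ind (PeakPair (put h k M) j) + ind (j = k ∧ PeakPair h j) +
        ind (j = k + 1 ∧ PeakPair h j) + ind (j = k - 1 ∧ PeakPair h j) +
        ind (j = k + 2 ∧ PeakPair h j) + ind (j = k - 2 ∧ PeakPair h j) := by
  rcases offset_four j with q | q <;>
  rcases offset_cases k j with rfl | rfl | rfl | rfl | rfl | e <;>
  simp only [offset_nf, offset_ne hm, IsPeak, PeakPair, put, Function.update_apply,
    ind, true_and, false_and, if_true, if_false, *] at * <;>
  split_ifs <;> omega

end Put

/-! ### Effect of a removed roof piece on each pattern -/

section Remove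
variable {m : ℕ}

theorem ind_isPeak_remove_le (hm : 4 ≤ m) (h g : ZMod m → ℕ) (k : ZMod m)
    (hk : IsPeak h k) (hg : g k ≤ h k) (j : ZMod m) :
    ind (IsPeak (put h k (g k)) j) + ind (j = k) ≤
      ind (IsPeak h j) + ind (j = k ∧ CoversSelf h g j) +
        ind (j = k + 1 ∧ CoversRight h g (j - 1)) + ind (j = k - 1 ∧ CoversLeft h g (j + 1)) := by
  rcases offset_four j with q | q <;>
  rcases offset_cases k j with rfl | rfl | rfl | rfl | rfl | e <;>
  simp only [offset_nf, offset_ne hm, IsPeak, CoversSelf, CoversRight, CoversLeft, put, Function.update_apply,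
    ind, true_and, false_and, if_true, if_false, *] at * <;>
  split_ifs <;> omega

/-- The new second height `w` is arbitrary. Patterns at `k` and `k ± 1` after the removal therefore
stay on the right-hand side, to be bounded together in `exposed_weight_le`. -/
theorem ind_coversSelf_remove_le (hm : 4 ≤ m) (h g : ZMod m → ℕ) (k : ZMod m) (w : ℕ)
    (hk : IsPeak h k) (hg : g k ≤ h k) (j : ZMod m) :
    ind (CoversSelf (put h k (g k)) (put g k w) j) + ind (j = k ∧ CoversSelf h g j) ≤
      ind (CoversSelf h g j) + ind (j = k ∧ CoversSelf (put h k (g k)) (put g k w) j) +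
        ind (j = k + 1 ∧ CoversSelf (put h k (g k)) (put g k w) j) +
        ind (j = k - 1 ∧ CoversSelf (put h k (g k)) (put g k w) j) := by
  rcases offset_four j with q | q <;>
  rcases offset_cases k j with rfl | rfl | rfl | rfl | rfl | e <;>
  simp only [offset_nf, offset_ne hm, IsPeak, CoversSelf, put, Function.update_apply,
    ind, true_and, false_and, if_true, if_false, *] at * <;>
  split_ifs <;> omega

/-- Besides the exposed columns, a gain occurs only at `k - 2`: if column `k - 1` was held by `k -
2` and `k`, then after the removal it is blocked by `k - 2` alone. -/
theorem ind_coversRight_remove_le (hm : 4 ≤ m) (h g : ZMod m → ℕ) (k : ZMod m) (w : ℕ)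
    (hk : IsPeak h k) (hg : g k ≤ h k) (j : ZMod m) :
    ind (CoversRight (put h k (g k)) (put g k w) j) + ind (j = k ∧ CoversRight h g j) ≤
      ind (CoversRight h g j) + ind (j = k ∧ CoversRight (put h k (g k)) (put g k w) j) +
        ind (j = k + 1 ∧ CoversRight (put h k (g k)) (put g k w) j) +
        ind (j = k - 1 ∧ CoversRight (put h k (g k)) (put g k w) j) +
        ind (j = k - 2 ∧ Held h g (j + 1)) := by
  rcases offset_four j with q | q <;>
  rcases offset_cases k j with rfl | rfl | rfl | rfl | rfl | e <;>
  simp only [offset_nf, offset_ne hm, IsPeak, PeakPair, Held, CoversRight, put, Function.update_apply,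
    ind, true_and, false_and, if_true, if_false, *] at * <;>
  split_ifs <;> omega

theorem ind_coversLeft_remove_le (hm : 4 ≤ m) (h g : ZMod m → ℕ) (k : ZMod m) (w : ℕ)
    (hk : IsPeak h k) (hg : g k ≤ h k) (j : ZMod m) :
    ind (CoversLeft (put h k (g k)) (put g k w) j) + ind (j = k ∧ CoversLeft h g j) ≤
      ind (CoversLeft h g j) + ind (j = k ∧ CoversLeft (put h k (g k)) (put g k w) j) +
        ind (j = k + 1 ∧ CoversLeft (put h k (g k)) (put g k w) j) +
        ind (j = k - 1 ∧ CoversLeft (put h k (g k)) (put g k w) j) +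
        ind (j = k + 2 ∧ Held h g (j - 1)) := by
  rcases offset_four j with q | q <;>
  rcases offset_cases k j with rfl | rfl | rfl | rfl | rfl | e <;>
  simp only [offset_nf, offset_ne hm, IsPeak, PeakPair, Held, CoversLeft, put, Function.update_apply,
    ind, true_and, false_and, if_true, if_false, *] at * <;>
  split_ifs <;> omega

theorem ind_held_remove_le (hm : 4 ≤ m) (h g : ZMod m → ℕ) (k : ZMod m) (w : ℕ)
    (hg : g k ≤ h k) (j : ZMod m) :
    ind (Held (put h k (g k)) (put g k w) j) + ind (j = k + 1 ∧ Held h g j) + ind (j = k - 1 ∧ Held h g j) ≤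
      ind (Held h g j) + ind (j = k ∧ Held (put h k (g k)) (put g k w) j) +
        ind (j = k + 1 ∧ Held (put h k (g k)) (put g k w) j) +
        ind (j = k - 1 ∧ Held (put h k (g k)) (put g k w) j) +
        ind (j = k + 2 ∧ Held (put h k (g k)) (put g k w) j) +
        ind (j = k - 2 ∧ Held (put h k (g k)) (put g k w) j) := by
  by_cases hj : j = k ∨ j = k + 1 ∨ j = k - 1 ∨ j = k + 2 ∨ j = k - 2
  · rcases hj with rfl | rfl | rfl | rfl | rfl <;>
    simp only [offset_ne hm, ind, true_and, false_and, if_false] <;>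
    split_ifs <;> omega
  · rcases offset_cases k j with rfl | rfl | rfl | rfl | rfl | ⟨e1, e2, e3, e4, e5, e⟩
    · simp at hj
    · simp at hj
    · simp at hj
    · simp at hj
    · simp at hj
    · simp only [e, IsPeak, PeakPair, Held, offset_nf, put, Function.update_apply, e1, e2, e3, e4,
        e5, ind, false_and, if_false]
      split_ifs <;> omega

theorem ind_coversBoth_le_remove (hm : 4 ≤ m) (h g : ZMod m → ℕ) (k : ZMod m) (w : ℕ)
    (hk : IsPeak h k) (hg : g k ≤ h k) (j : ZMod m) :
    ind (CoversBoth h g j) + ind (j = k ∧ CoversBoth (put h k (g k)) (put g k w) j) +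
      ind (j = k + 1 ∧ CoversBoth (put h k (g k)) (put g k w) j) +
      ind (j = k - 1 ∧ CoversBoth (put h k (g k)) (put g k w) j) ≤
      ind (CoversBoth (put h k (g k)) (put g k w) j) + ind (j = k ∧ CoversBoth h g j) := by
  rcases offset_four j with q | q <;>
  rcases offset_cases k j with rfl | rfl | rfl | rfl | rfl | e <;>
  simp only [offset_nf, offset_ne hm, IsPeak, CoversBoth, CoversRight, CoversLeft, put, Function.update_apply,
    ind, true_and, false_and, if_true, if_false, *] at * <;>
  split_ifs <;> omega

theorem ind_peakPair_le_remove (hm : 4 ≤ m) (h g : ZMod m → ℕ) (k : ZMod m)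
    (hk : IsPeak h k) (hg : g k ≤ h k) (j : ZMod m) :
    ind (PeakPair h j) ≤ ind (PeakPair (put h k (g k)) j) +
      ind (j = k + 1 ∧ PeakPair h j) + ind (j = k - 1 ∧ PeakPair h j) := by
  rcases offset_four j with q | q <;>
  rcases offset_cases k j with rfl | rfl | rfl | rfl | rfl | e <;>
  simp only [offset_nf, offset_ne hm, IsPeak, PeakPair, put, Function.update_apply,
    ind, true_and, false_and, if_true, if_false, *] at * <;>
  split_ifs <;> omega

/-- The weight carried by a single roof piece is at most `90`. -/
theorem weight_le (h g : ZMod m → ℕ) (j : ZMod m) :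
    60 * ind (CoversSelf h g j) + 48 * (ind (CoversRight h g j) + ind (CoversLeft h g j)) +
      12 * (ind (Held h g (j - 1)) + ind (Held h g (j + 1))) - 6 * ind (CoversBoth h g j) ≤
      90 * ind (IsPeak h j) := by
  -- The patterns exclude one another: covering oneself needs `g j` above both neighbours, the
  -- others need it below one. Covering right needs `h (j + 2) < h (j + 1)`, while a held column `j
  -- + 1` lies below `j + 2`. The extreme case is covering both sides, of weight 48 + 48 - 6 = 90.
  have hS : CoversSelf h g j → IsPeak h j ∧ ¬ CoversRight h g j ∧ ¬ CoversLeft h g j ∧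
      ¬ Held h g (j - 1) ∧ ¬ Held h g (j + 1) := by
    simp only [offset_nf, IsPeak, PeakPair, Held, CoversSelf, CoversRight, CoversLeft]
    omega
  have hR : CoversRight h g j → IsPeak h j ∧ ¬ Held h g (j + 1) := by
    simp only [offset_nf, IsPeak, PeakPair, Held, CoversRight]
    omega
  have hL : CoversLeft h g j → IsPeak h j ∧ ¬ Held h g (j - 1) := by
    simp only [offset_nf, IsPeak, PeakPair, Held, CoversLeft]
    omega
  have hH : (Held h g (j - 1) → IsPeak h j) ∧ (Held h g (j + 1) → IsPeak h j) := by
    simp only [offset_nf, PeakPair, Held]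
    tauto
  have hB : CoversBoth h g j ↔ CoversLeft h g j ∧ CoversRight h g j := Iff.rfl
  have i1 := ind_add_le (fun p => (hS p).1) (fun p => (hR p).1) (fun p => (hS p).2.1)
  have i2 := ind_add_le (fun p => (hS p).1) (fun p => (hL p).1) (fun p => (hS p).2.2.1)
  have i3 := ind_add_le (fun p => (hS p).1) hH.1 (fun p => (hS p).2.2.2.1)
  have i4 := ind_add_le (fun p => (hS p).1) hH.2 (fun p => (hS p).2.2.2.2)
  have i5 := ind_add_le (fun p => (hR p).1) hH.2 (fun p => (hR p).2)
  have i6 := ind_add_le (fun p => (hL p).1) hH.1 (fun p => (hL p).2)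
  have i7 : ind (CoversRight h g j) + ind (CoversLeft h g j) ≤ 1 + ind (CoversBoth h g j) := by
    unfold ind
    split_ifs <;> first | omega | (exfalso; tauto)
  have := ind_nonneg (CoversSelf h g j)
  have := ind_nonneg (CoversRight h g j)
  have := ind_nonneg (CoversLeft h g j)
  have := ind_nonneg (CoversBoth h g j)
  have := ind_nonneg (Held h g (j - 1))
  have := ind_nonneg (Held h g (j + 1))
  have := ind_le_one (IsPeak h j)
  omega

/-- A roof piece at `c - 1` prevents `c + 1` from covering left, which lowers the bound 90 to 60.
The value 60 needs `CoversSelf`, impossible when `c` is held; otherwise at most 48 remains. -/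
theorem weight_right_le (h g : ZMod m → ℕ) (c : ZMod m) (hc : IsPeak h (c - 1)) :
    60 * ind (CoversSelf h g (c + 1)) +
      48 * (ind (CoversRight h g (c + 1)) + ind (CoversLeft h g (c + 1))) +
      12 * ind (Held h g (c + 2)) - 6 * ind (CoversBoth h g (c + 1)) ≤
      60 - 12 * ind (Held h g c) := by
  simp only [offset_nf, IsPeak, PeakPair, Held, CoversSelf, CoversBoth, CoversRight, CoversLeft,
    ind, show c + 3 - 1 = c + 2 by ring] at *
  split_ifs <;> omega

theorem weight_left_le (h g : ZMod m → ℕ) (c : ZMod m) (hc : IsPeak h (c + 1)) :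
    60 * ind (CoversSelf h g (c - 1)) +
      48 * (ind (CoversRight h g (c - 1)) + ind (CoversLeft h g (c - 1))) +
      12 * ind (Held h g (c - 2)) - 6 * ind (CoversBoth h g (c - 1)) ≤
      60 - 12 * ind (Held h g c) := by
  simp only [offset_nf, IsPeak, PeakPair, Held, CoversSelf, CoversBoth, CoversRight, CoversLeft,
    ind, show c - 3 + 1 = c - 2 by ring] at *
  split_ifs <;> omega

end Remove

/-! ### The potential and its total change over all drops -/

section Potential
variable {m : ℕ}

theorem sum_ind_and [NeZero m] (a : ZMod m) (p : ZMod m → Prop) [DecidablePred p] :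
    ∑ j, ind (j = a ∧ p j) = ind (p a) := by
  rw [Finset.sum_eq_single a] <;> simp +contextual [ind]

theorem sum_ind_eq [NeZero m] (a : ZMod m) : ∑ j, ind (j = a) = 1 := by
  rw [Finset.sum_eq_single a] <;> simp +contextual [ind]

theorem ind_of_not {p : Prop} [Decidable p] (h : ¬ p) : ind p = 0 := if_neg h

theorem ind_of {p : Prop} [Decidable p] (h : p) : ind p = 1 := if_pos h

theorem ind_congr {p q : Prop} [Decidable p] [Decidable q] (h : p ↔ q) : ind p = ind q := by
  unfold ind; split_ifs <;> first | rfl | (exfalso; tauto)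

/-- The potential of a heap with column heights `h` and second heights `g`. -/
def potential [NeZero m] (h g : ZMod m → ℕ) : ℤ :=
  270 * ∑ j, ind (IsPeak h j) + 60 * ∑ j, ind (CoversSelf h g j) +
    48 * (∑ j, ind (CoversRight h g j) + ∑ j, ind (CoversLeft h g j)) +
    12 * ∑ j, ind (Held h g j) - 6 * ∑ j, ind (CoversBoth h g j) - ∑ j, ind (PeakPair h j)

/-- The bound for the change of the potential when a piece is added to column `k`. -/
def addBound (h g : ZMod m → ℕ) (k : ZMod m) : ℤ :=
  270 * (1 - ind (IsPeak h k) - ind (IsPeak h (k + 1)) - ind (IsPeak h (k - 1))) +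
  60 * (ind (IsPeak h k) - ind (CoversSelf h g k) - ind (CoversSelf h g (k + 1)) -
    ind (CoversSelf h g (k - 1))) +
  48 * (ind (IsPeak h (k + 1)) + ind (IsPeak h (k - 1)) -
    ind (CoversRight h g k) - ind (CoversRight h g (k + 1)) - ind (CoversRight h g (k - 1)) -
    ind (CoversRight h g (k - 2)) -
    ind (CoversLeft h g k) - ind (CoversLeft h g (k + 1)) - ind (CoversLeft h g (k - 1)) -
    ind (CoversLeft h g (k + 2))) +
  12 * (ind (CoversLeft h g (k + 2)) + ind (CoversRight h g (k - 2)) -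
    ind (Held h g k) - ind (Held h g (k + 1)) - ind (Held h g (k - 1)) - ind (Held h g (k + 2))) -
  6 * (ind (PeakPair h k) - ind (CoversBoth h g k) - ind (CoversBoth h g (k + 1)) -
    ind (CoversBoth h g (k - 1)) - ind (CoversBoth h g (k + 2)) - ind (CoversBoth h g (k - 2))) -
  (ind (IsPeak h (k + 2)) + ind (IsPeak h (k - 2)) - ind (PeakPair h k) -
    ind (PeakPair h (k + 1)) - ind (PeakPair h (k - 1)) - ind (PeakPair h (k + 2)) -
    ind (PeakPair h (k - 2)))

theorem potential_put_sub_le [NeZero m] (hm : 4 ≤ m) (h g : ZMod m → ℕ) (k : ZMod m) (M : ℕ)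
    (h0 : h k < M) (hl : h (k - 1) < M) (hr : h (k + 1) < M) :
    potential (put h k M) (put g k (h k)) - potential h g ≤ addBound h g k := by
  have e1 := Finset.sum_le_sum fun j (_ : j ∈ Finset.univ) =>
    ind_isPeak_put_le hm h k M h0 hl hr j
  have e2 := Finset.sum_le_sum fun j (_ : j ∈ Finset.univ) =>
    ind_coversSelf_put_le hm h g k M h0 hl hr j
  have e3 := Finset.sum_le_sum fun j (_ : j ∈ Finset.univ) =>
    ind_coversRight_put_le hm h g k M h0 hl hr j
  have e4 := Finset.sum_le_sum fun j (_ : j ∈ Finset.univ) =>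
    ind_coversLeft_put_le hm h g k M h0 hl hr j
  have e5 := Finset.sum_le_sum fun j (_ : j ∈ Finset.univ) =>
    ind_held_put_le hm h g k M h0 hl hr j
  have e6 := Finset.sum_le_sum fun j (_ : j ∈ Finset.univ) =>
    ind_coversBoth_le_put hm h g k M h0 hl hr j
  have e7 := Finset.sum_le_sum fun j (_ : j ∈ Finset.univ) =>
    ind_peakPair_le_put hm h k M h0 hl hr j
  simp only [Finset.sum_add_distrib, sum_ind_eq, sum_ind_and] at e1 e2 e3 e4 e5 e6 e7
  have r1 : k + 1 + 1 = k + 2 := by ring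
  have r2 : k - 1 - 1 = k - 2 := by ring
  rw [r1, r2] at e5 e7
  unfold potential addBound
  linarith

theorem Held.isPeak_left {h g : ZMod m → ℕ} {c : ZMod m} (H : Held h g (c + 1)) : IsPeak h c := by
  have := H.1.1
  rwa [add_sub_cancel_right] at this

theorem Held.isPeak_right {h g : ZMod m → ℕ} {c : ZMod m} (H : Held h g (c - 1)) : IsPeak h c := by
  have := H.1.2
  rwa [sub_add_cancel] at this

theorem ind_zero_of_not_isPeak {h : ZMod m → ℕ} (g : ZMod m → ℕ) {k : ZMod m}
    (hk : ¬ IsPeak h k) :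
    ind (CoversSelf h g k) = 0 ∧ ind (CoversRight h g k) = 0 ∧ ind (CoversLeft h g k) = 0 ∧
      ind (CoversBoth h g k) = 0 ∧ ind (Held h g (k + 1)) = 0 ∧ ind (Held h g (k - 1)) = 0 :=
  ⟨ind_of_not fun H => hk H.1, ind_of_not fun H => hk H.1, ind_of_not fun H => hk H.1,
    ind_of_not fun H => hk H.1.1, ind_of_not fun H => hk H.isPeak_left,
    ind_of_not fun H => hk H.isPeak_right⟩

/-- Each column put into the roof by the removal carries weight at most 90. If both neighbours are
exposed, they face each other across `k`, and the sharper one-sided bounds save 60. The second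
heights `g'` are unrestricted. -/
theorem exposed_weight_le (hm : 4 ≤ m) (h g : ZMod m → ℕ) (k : ZMod m)
    (hk : IsPeak h k) (h' g' : ZMod m → ℕ) (hh : h' = put h k (g k)) :
    60 * (ind (CoversSelf h' g' k) + ind (CoversSelf h' g' (k + 1)) +
        ind (CoversSelf h' g' (k - 1))) +
      48 * (ind (CoversRight h' g' k) + ind (CoversRight h' g' (k + 1)) +
        ind (CoversRight h' g' (k - 1)) + ind (CoversLeft h' g' k) +
        ind (CoversLeft h' g' (k + 1)) + ind (CoversLeft h' g' (k - 1))) +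
      12 * (ind (Held h' g' k) + ind (Held h' g' (k + 1)) + ind (Held h' g' (k - 1)) +
        ind (Held h' g' (k + 2)) + ind (Held h' g' (k - 2))) -
      6 * (ind (CoversBoth h' g' k) + ind (CoversBoth h' g' (k + 1)) +
        ind (CoversBoth h' g' (k - 1))) ≤
    90 * (ind (CoversSelf h g k) + ind (CoversRight h g k) + ind (CoversLeft h g k)) -
      60 * ind (CoversBoth h g k) := by
  have p0 : IsPeak h' k ↔ CoversSelf h g k := by
    subst hh
    simp only [IsPeak, CoversSelf, put, Function.update_apply, offset_ne hm, if_true,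
      if_false] at hk ⊢
    tauto
  have p1 : IsPeak h' (k + 1) ↔ CoversRight h g k := by
    subst hh
    simp only [IsPeak, CoversRight, put, Function.update_apply, offset_nf, offset_ne hm, if_true,
      if_false] at hk ⊢
    tauto
  have p2 : IsPeak h' (k - 1) ↔ CoversLeft h g k := by
    subst hh
    simp only [IsPeak, CoversLeft, put, Function.update_apply, offset_nf, offset_ne hm, if_true,
      if_false] at hk ⊢
    tauto
  have x1 : CoversSelf h g k → ¬ CoversRight h g k ∧ ¬ CoversLeft h g k := by
    simp only [CoversSelf, CoversRight, CoversLeft]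
    omega
  have a0 := weight_le h' g' k
  have a1 := weight_le h' g' (k + 1)
  have a2 := weight_le h' g' (k - 1)
  have b1 := weight_right_le h' g' k
  have b2 := weight_left_le h' g' k
  have z0 := fun H => ind_zero_of_not_isPeak (h := h') g' (k := k) H
  have z1 := fun H => ind_zero_of_not_isPeak (h := h') g' (k := k + 1) H
  have z2 := fun H => ind_zero_of_not_isPeak (h := h') g' (k := k - 1) H
  have n0 := ind_nonneg (Held h' g' k)
  simp only [offset_nf] at a0 a1 a2 z0 z1 z2
  by_cases c0 : CoversSelf h g k
  · obtain ⟨c1, c2⟩ := x1 c0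
    rw [ind_of (p0.2 c0)] at a0
    obtain ⟨_, _, _, _, _, _⟩ := z1 (mt p1.1 c1)
    obtain ⟨_, _, _, _, _, _⟩ := z2 (mt p2.1 c2)
    rw [ind_of c0, ind_of_not c1, ind_of_not c2, ind_of_not (p := CoversBoth h g k) (fun H => c1 H.2)]
    linarith
  · obtain ⟨_, _, _, _, _, _⟩ := z0 (mt p0.1 c0)
    rw [ind_of_not c0]
    by_cases c1 : CoversRight h g k <;> by_cases c2 : CoversLeft h g k
    -- Each neighbour carries at most 60, less 12 if `k` is now held; adding the weight 12 of that
    -- pattern keeps the total at most 120 = 2 * 90 - 60.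
    · have b1 := b1 (p2.2 c2)
      have b2 := b2 (p1.2 c1)
      rw [ind_of c1, ind_of c2, ind_of (p := CoversBoth h g k) ⟨c2, c1⟩]
      linarith
    · obtain ⟨_, _, _, _, _, _⟩ := z2 (mt p2.1 c2)
      rw [ind_of (p1.2 c1)] at a1
      rw [ind_of c1, ind_of_not c2, ind_of_not (p := CoversBoth h g k) (fun H => c2 H.1)]
      linarith
    · obtain ⟨_, _, _, _, _, _⟩ := z1 (mt p1.1 c1)
      rw [ind_of (p2.2 c2)] at a2
      rw [ind_of_not c1, ind_of c2, ind_of_not (p := CoversBoth h g k) (fun H => c1 H.2)]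
      linarith
    · obtain ⟨_, _, _, _, _, _⟩ := z1 (mt p1.1 c1)
      obtain ⟨_, _, _, _, _, _⟩ := z2 (mt p2.1 c2)
      rw [ind_of_not c1, ind_of_not c2, ind_of_not (p := CoversBoth h g k) (fun H => c1 H.2)]
      linarith

/-- The bound for the change of the potential when the roof piece of column `k` is removed. -/
def removeBound (h g : ZMod m → ℕ) (k : ZMod m) : ℤ :=
  -270 * ind (IsPeak h k) + 300 * ind (CoversSelf h g k) +
    312 * (ind (CoversRight h g k) + ind (CoversLeft h g k)) +
    36 * (ind (Held h g (k + 1)) + ind (Held h g (k - 1))) - 54 * ind (CoversBoth h g k) +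
    (ind (PeakPair h (k + 1)) + ind (PeakPair h (k - 1)))

theorem potential_remove_sub_le [NeZero m] (hm : 4 ≤ m) (h g : ZMod m → ℕ) (k : ZMod m) (w : ℕ)
    (hk : IsPeak h k) (hg : g k ≤ h k) :
    potential (put h k (g k)) (put g k w) - potential h g ≤ removeBound h g k := by
  have e1 := Finset.sum_le_sum fun j (_ : j ∈ Finset.univ) =>
    ind_isPeak_remove_le hm h g k hk hg j
  have e2 := Finset.sum_le_sum fun j (_ : j ∈ Finset.univ) =>
    ind_coversSelf_remove_le hm h g k w hk hg j
  have e3 := Finset.sum_le_sum fun j (_ : j ∈ Finset.univ) =>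
    ind_coversRight_remove_le hm h g k w hk hg j
  have e4 := Finset.sum_le_sum fun j (_ : j ∈ Finset.univ) =>
    ind_coversLeft_remove_le hm h g k w hk hg j
  have e5 := Finset.sum_le_sum fun j (_ : j ∈ Finset.univ) =>
    ind_held_remove_le hm h g k w hg j
  have e6 := Finset.sum_le_sum fun j (_ : j ∈ Finset.univ) =>
    ind_coversBoth_le_remove hm h g k w hk hg j
  have e7 := Finset.sum_le_sum fun j (_ : j ∈ Finset.univ) =>
    ind_peakPair_le_remove hm h g k hk hg j
  simp only [Finset.sum_add_distrib, sum_ind_eq, sum_ind_and, offset_nf] at e1 e2 e3 e4 e5 e6 e7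
  have e8 := exposed_weight_le hm h g k hk _ (put g k w) rfl
  unfold potential removeBound
  rw [ind_of hk]
  linarith

/-- On the roof, `addBound` only involves the column itself. -/
theorem addBound_of_isPeak (h g : ZMod m → ℕ) (k : ZMod m) (hk : IsPeak h k) :
    addBound h g k = 60 * (ind (IsPeak h k) - ind (CoversSelf h g k)) -
      48 * (ind (CoversRight h g k) + ind (CoversLeft h g k)) -
      12 * (ind (Held h g (k + 1)) + ind (Held h g (k - 1))) + 6 * ind (CoversBoth h g k) := by
  have q1 : ¬ IsPeak h (k + 1) := fun H => by
    have := H.1; rw [add_sub_cancel_right] at this; exact absurd hk.2 (by omega)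
  have q2 : ¬ IsPeak h (k - 1) := fun H => by
    have := H.2; rw [sub_add_cancel] at this; exact absurd hk.1 (by omega)
  have r1 : k - 2 + 1 = k - 1 := by ring
  have r2 : k - 2 + 2 = k := by ring
  have r3 : k + 2 - 1 = k + 1 := by ring
  have r4 : k + 2 - 2 = k := by ring
  have r5 : k + 1 + 1 = k + 2 := by ring
  have r6 : k - 1 - 1 = k - 2 := by ring
  have q3 : ¬ CoversRight h g (k - 2) := fun H => by
    have := H.2.2; rw [r1, r2] at this; exact absurd hk.1 (by omega)
  have q4 : ¬ CoversLeft h g (k + 2) := fun H => by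
    have := H.2.2; rw [r3, r4] at this; exact absurd hk.2 (by omega)
  have q5 : ¬ PeakPair h k := fun H => q1 H.2
  have q6 : ¬ PeakPair h (k + 2) := fun H => q1 (r3 ▸ H.1)
  have q7 : ¬ PeakPair h (k - 2) := fun H => q2 (r1 ▸ H.2)
  have q8 : ¬ CoversBoth h g (k - 2) := fun H => q3 H.2
  have q9 : ¬ CoversBoth h g (k + 2) := fun H => q4 H.1
  obtain ⟨z1, z2, z3, z4, z5, z6⟩ := ind_zero_of_not_isPeak g q1
  obtain ⟨y1, y2, y3, y4, y5, y6⟩ := ind_zero_of_not_isPeak g q2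
  have w1 : ind (PeakPair h (k + 1)) = ind (IsPeak h (k + 2)) := ind_congr (by
    unfold PeakPair; rw [add_sub_cancel_right, r5]; tauto)
  have w2 : ind (PeakPair h (k - 1)) = ind (IsPeak h (k - 2)) := ind_congr (by
    unfold PeakPair; rw [sub_add_cancel, r6]; tauto)
  rw [r5] at z5
  rw [add_sub_cancel_right] at z6
  unfold addBound
  rw [ind_of hk, ind_of_not q1, ind_of_not q2, z1, z2, z3, z4, y1, y2, y3, y4, z5, z6,
    ind_of_not q3, ind_of_not q4, ind_of_not q5, ind_of_not q6, ind_of_not q7, ind_of_not q8,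
    ind_of_not q9, w1, w2]
  ring

theorem sum_bounds [NeZero m] (h g : ZMod m → ℕ) :
    ∑ k, (if IsPeak h k then addBound h g k + removeBound h g k else 2 * addBound h g k) =
      2 * (270 * m - 821 * ∑ k, ind (IsPeak h k)) := by
  -- The difference `removeBound - addBound` on a roof column is written with terms that all vanish
  -- off the roof, so one formula serves every column.
  have key : ∀ k, (if IsPeak h k then addBound h g k + removeBound h g k else 2 * addBound h g k) =
      2 * addBound h g k + (-330 * ind (IsPeak h k) + 360 * ind (CoversSelf h g k) +
        360 * (ind (CoversRight h g k) + ind (CoversLeft h g k)) +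
        48 * (ind (Held h g (k + 1)) + ind (Held h g (k - 1))) - 60 * ind (CoversBoth h g k) +
        (ind (PeakPair h (k + 1)) + ind (PeakPair h (k - 1)))) := by
    intro k
    split_ifs with hk
    · rw [addBound_of_isPeak h g k hk, removeBound]
      ring
    · obtain ⟨z1, z2, z3, z4, z5, z6⟩ := ind_zero_of_not_isPeak g hk
      have q1 : ¬ PeakPair h (k + 1) := fun H => hk (by
        have := H.1; rwa [add_sub_cancel_right] at this)
      have q2 : ¬ PeakPair h (k - 1) := fun H => hk (by
        have := H.2; rwa [sub_add_cancel] at this)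
      rw [z1, z2, z3, z4, z5, z6, ind_of_not hk, ind_of_not q1, ind_of_not q2]
      ring
  have sh : ∀ (f : ZMod m → ℤ) (a : ZMod m), ∑ k, f (k + a) = ∑ k, f k := fun f a =>
    Equiv.sum_comp (Equiv.addRight a) f
  have sh' : ∀ (f : ZMod m → ℤ) (a : ZMod m), ∑ k, f (k - a) = ∑ k, f k := fun f a =>
    Equiv.sum_comp (Equiv.subRight a) f
  rw [Finset.sum_congr rfl fun k _ => key k]
  -- Cyclic shifts do not change the sums, so only coefficients matter. Those of the auxiliary
  -- patterns cancel, and the roof count gets 2(-810 + 60 + 96 - 2) - 330 = -2 * 821.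
  simp only [addBound, Finset.sum_add_distrib, Finset.sum_sub_distrib, ← Finset.mul_sum,
    sh (fun k => ind (IsPeak h k)), sh' (fun k => ind (IsPeak h k)),
    sh (fun k => ind (CoversSelf h g k)), sh' (fun k => ind (CoversSelf h g k)),
    sh (fun k => ind (CoversRight h g k)), sh' (fun k => ind (CoversRight h g k)),
    sh (fun k => ind (CoversLeft h g k)), sh' (fun k => ind (CoversLeft h g k)),
    sh (fun k => ind (CoversBoth h g k)), sh' (fun k => ind (CoversBoth h g k)),
    sh (fun k => ind (Held h g k)), sh' (fun k => ind (Held h g k)),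
    sh (fun k => ind (PeakPair h k)), sh' (fun k => ind (PeakPair h k)),
    Finset.sum_const, Finset.card_univ, ZMod.card, nsmul_eq_mul]
  ring

theorem abs_potential_le [NeZero m] (h g : ZMod m → ℕ) : |potential h g| ≤ 500 * m := by
  have b : ∀ (p : ZMod m → Prop) [DecidablePred p], 0 ≤ ∑ j, ind (p j) ∧ ∑ j, ind (p j) ≤ m := by
    intro p _
    refine ⟨Finset.sum_nonneg fun j _ => ind_nonneg _, ?_⟩
    refine (Finset.sum_le_sum fun j _ => ind_le_one (p j)).trans ?_
    simp [ZMod.card]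
  have b1 := b (IsPeak h)
  have b2 := b (CoversSelf h g)
  have b3 := b (CoversRight h g)
  have b4 := b (CoversLeft h g)
  have b5 := b (Held h g)
  have b6 := b (CoversBoth h g)
  have b7 := b (PeakPair h)
  unfold potential
  rw [abs_le]
  constructor <;> linarith [b1.1, b1.2, b2.1, b2.2, b3.1, b3.2, b4.1, b4.2, b5.1, b5.2, b6.1, b6.2,
    b7.1, b7.2]

end Potential

/-! ### From heaps of pieces to height profiles -/

section Heap
variable {m : ℕ}

/-- The height of the second highest piece in column `k`, and `0` if there is none. -/
def secondHeight (H : Finset (Piece m)) (k : ZMod m) : ℕ :=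
  (H.filter (fun p => p.col = k ∧ p.height < colHeight H k)).sup Piece.height

/-- Pieces have positive height, and no two pieces of the same column or of adjacent columns have
the same height. -/
structure IsHeap (H : Finset (Piece m)) : Prop where
  pos : ∀ p ∈ H, 0 < p.height
  inj : ∀ p ∈ H, ∀ q ∈ H, p.col = q.col → p.height = q.height → p = q
  adj : ∀ p ∈ H, ∀ q ∈ H, q.col = p.col + 1 → p.height ≠ q.height

theorem height_le_colHeight {H : Finset (Piece m)} {p : Piece m} (hp : p ∈ H) :
    p.height ≤ colHeight H p.col :=
  Finset.le_sup (f := Piece.height) (by simp [hp])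

theorem exists_height_eq_colHeight {H : Finset (Piece m)} {k : ZMod m}
    (hk : 0 < colHeight H k) : ∃ p ∈ H, p.col = k ∧ p.height = colHeight H k := by
  have hne : (H.filter (fun p => p.col = k)).Nonempty := by
    rw [Finset.nonempty_iff_ne_empty]
    intro h
    simp [colHeight, h] at hk
  obtain ⟨p, hp, he⟩ := Finset.exists_mem_eq_sup _ hne Piece.height
  rw [Finset.mem_filter] at hp
  exact ⟨p, hp.1, hp.2, he.symm⟩

theorem secondHeight_le_colHeight (H : Finset (Piece m)) (k : ZMod m) :
    secondHeight H k ≤ colHeight H k :=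
  Finset.sup_mono fun p hp => by
    simp only [Finset.mem_filter] at hp ⊢
    exact ⟨hp.1, hp.2.1⟩

theorem colHeight_insert (H : Finset (Piece m)) (p : Piece m) (hp : colHeight H p.col < p.height) :
    colHeight (insert p H) = put (colHeight H) p.col p.height := by
  funext j
  by_cases hj : j = p.col
  · subst hj
    simp only [put, Function.update_self, colHeight, Finset.filter_insert, if_true,
      Finset.sup_insert]
    exact sup_of_le_left hp.le
  · simp only [put, Function.update_of_ne hj, colHeight, Finset.filter_insert]
    rw [if_neg (Ne.symm hj)]

theorem secondHeight_insert (H : Finset (Piece m)) (p : Piece m)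
    (hp : colHeight H p.col < p.height) :
    secondHeight (insert p H) = put (secondHeight H) p.col (colHeight H p.col) := by
  funext j
  rw [secondHeight, colHeight_insert H p hp]
  by_cases hj : j = p.col
  · subst hj
    simp only [put, Function.update_self, Finset.filter_insert, lt_irrefl, and_false, if_false]
    rw [colHeight]
    congr 1
    refine Finset.filter_congr fun q hq => and_iff_left_of_imp fun hc => ?_
    have := height_le_colHeight hq
    rw [hc] at this
    omega
  · simp only [put, Function.update_of_ne hj, Finset.filter_insert]
    rw [if_neg fun h => hj h.1.symm, secondHeight]

theorem colHeight_erase {H : Finset (Piece m)} (hH : IsHeap H) (p : Piece m) (hp : p ∈ H)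
    (ht : p.height = colHeight H p.col) :
    colHeight (H.erase p) = put (colHeight H) p.col (secondHeight H p.col) := by
  funext j
  by_cases hj : j = p.col
  · subst hj
    simp only [put, Function.update_self]
    rw [colHeight, secondHeight]
    congr 1
    ext q
    simp only [Finset.mem_filter, Finset.mem_erase]
    constructor
    · rintro ⟨⟨hne, hq⟩, hc⟩
      refine ⟨hq, hc, lt_of_le_of_ne (hc ▸ height_le_colHeight hq) fun he => hne ?_⟩
      exact hH.inj q hq p hp hc (he.trans ht.symm)
    · rintro ⟨hq, hc, hl⟩
      refine ⟨⟨?_, hq⟩, hc⟩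
      rintro rfl
      omega
  · simp only [put, Function.update_of_ne hj]
    rw [colHeight, colHeight]
    congr 1
    ext q
    simp only [Finset.mem_filter, Finset.mem_erase]
    constructor
    · rintro ⟨⟨-, hq⟩, hc⟩; exact ⟨hq, hc⟩
    · rintro ⟨hq, hc⟩
      exact ⟨⟨fun h => hj (by rw [← hc, h]), hq⟩, hc⟩

/-- Only the other columns carry content: at `p.col` the new value is left unspecified and plays the
role of the arbitrary `w`. -/
theorem secondHeight_erase {H : Finset (Piece m)} (hH : IsHeap H) (p : Piece m) (hp : p ∈ H)
    (ht : p.height = colHeight H p.col) :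
    secondHeight (H.erase p) =
      put (secondHeight H) p.col (secondHeight (H.erase p) p.col) := by
  funext j
  by_cases hj : j = p.col
  · subst hj
    simp only [put, Function.update_self]
  · simp only [put, Function.update_of_ne hj]
    rw [secondHeight, colHeight_erase hH p hp ht, secondHeight]
    simp only [put, Function.update_of_ne hj]
    congr 1
    ext q
    simp only [Finset.mem_filter, Finset.mem_erase]
    constructor
    · rintro ⟨⟨-, hq⟩, hc⟩; exact ⟨hq, hc⟩
    · rintro ⟨hq, hc⟩
      exact ⟨⟨fun h => hj (by rw [← hc.1, h]), hq⟩, hc⟩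

theorem isHeap_empty : IsHeap (∅ : Finset (Piece m)) := ⟨by simp, by simp, by simp⟩

theorem IsHeap.drop {H : Finset (Piece m)} (hm : 4 ≤ m) (hH : IsHeap H) (x : ZMod m × Bool) :
    IsHeap (drop H x) := by
  unfold RandomHeap.drop
  split_ifs with hc
  · exact ⟨fun p hp => hH.pos p (Finset.mem_of_mem_erase hp),
      fun p hp q hq => hH.inj p (Finset.mem_of_mem_erase hp) q (Finset.mem_of_mem_erase hq),
      fun p hp q hq => hH.adj p (Finset.mem_of_mem_erase hp) q (Finset.mem_of_mem_erase hq)⟩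
  · have hlt : ∀ q ∈ H, q.col = x.1 - 1 ∨ q.col = x.1 ∨ q.col = x.1 + 1 →
        q.height < max (max (colHeight H (x.1 - 1)) (colHeight H x.1)) (colHeight H (x.1 + 1)) + 1 := by
      intro q hq h
      have := height_le_colHeight hq
      rcases h with h | h | h <;> rw [h] at this <;> omega
    have h1 := (one_two_three_ne_zero hm).1
    constructor
    · intro p hp
      rcases Finset.mem_insert.1 hp with rfl | hp
      · exact Nat.succ_pos _
      · exact hH.pos p hp
    · intro p hp q hq hpq he
      rcases Finset.mem_insert.1 hp with rfl | hp <;> rcases Finset.mem_insert.1 hq with rfl | hq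
      · rfl
      · exact absurd he (hlt q hq (.inr (.inl hpq.symm))).ne'
      · exact absurd he (hlt p hp (.inr (.inl hpq))).ne
      · exact hH.inj p hp q hq hpq he
    · intro p hp q hq hpq
      rcases Finset.mem_insert.1 hp with rfl | hp <;> rcases Finset.mem_insert.1 hq with rfl | hq
      · exact absurd (by simpa using hpq) h1
      · exact (hlt q hq (.inr (.inr hpq))).ne'
      · exact (hlt p hp (.inl (eq_sub_of_add_eq hpq.symm))).ne
      · exact hH.adj p hp q hq hpq

theorem isHeap_heapProcess (hm : 4 ≤ m) (x : ℕ → ZMod m × Bool) (n : ℕ) :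
    IsHeap (heapProcess x n) := by
  induction n with
  | zero => exact isHeap_empty
  | succ n ih => exact ih.drop hm _

/-- A roof piece is only known not to be below its neighbours; distinct heights in adjacent columns
make the comparison strict, as `IsPeak` demands. -/
theorem card_roof_le [NeZero m] {H : Finset (Piece m)} (hH : IsHeap H) :
    ((roof H).card : ℤ) ≤ ∑ k, ind (IsPeak (colHeight H) k) := by
  have top : ∀ p ∈ roof H, p ∈ H ∧ p.height = colHeight H p.col ∧ IsPeak (colHeight H) p.col := by
    intro p hp
    rw [roof, Finset.mem_filter] at hp
    obtain ⟨hp, hr⟩ := hp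
    have hpos := hH.pos p hp
    have hle := height_le_colHeight hp
    have nb : ∀ k, k = p.col - 1 ∨ k = p.col ∨ k = p.col + 1 → colHeight H k ≤ p.height := by
      intro k hk
      by_contra! hlt
      obtain ⟨q, hq, hc, he⟩ := exists_height_eq_colHeight (H := H) (k := k) (by omega)
      exact hr q hq (hc ▸ hk) (he ▸ hlt)
    have h0 := nb _ (.inr (.inl rfl))
    have hl := nb _ (.inl rfl)
    have hr := nb _ (.inr (.inr rfl))
    have heq : p.height = colHeight H p.col := le_antisymm hle h0
    refine ⟨hp, heq, ?_, ?_⟩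
    · rw [← heq]
      refine lt_of_le_of_ne hl fun he => ?_
      obtain ⟨q, hq, hc, he'⟩ := exists_height_eq_colHeight (H := H) (k := p.col - 1) (by omega)
      exact hH.adj q hq p hp (by rw [hc]; ring) (he'.trans he)
    · rw [← heq]
      refine lt_of_le_of_ne hr fun he => ?_
      obtain ⟨q, hq, hc, he'⟩ := exists_height_eq_colHeight (H := H) (k := p.col + 1) (by omega)
      exact hH.adj p hp q hq hc (he'.trans he).symm
  have hs : ∑ k, ind (IsPeak (colHeight H) k) =
      ((Finset.univ.filter (IsPeak (colHeight H))).card : ℤ) := by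
    rw [Finset.card_filter]
    push_cast
    rfl
  rw [hs]
  norm_cast
  refine Finset.card_le_card_of_injOn Piece.col (fun p hp => ?_) fun p hp q hq hpq => ?_
  · simpa using (top p hp).2.2
  · obtain ⟨p1, p2, -⟩ := top p hp
    obtain ⟨q1, q2, -⟩ := top q hq
    exact hH.inj p p1 q q1 hpq (by rw [p2, q2, hpq])

/-- The potential of a heap. -/
def heapPotential [NeZero m] (H : Finset (Piece m)) : ℤ := potential (colHeight H) (secondHeight H)

theorem heapPotential_insert_sub_le [NeZero m] (hm : 4 ≤ m) (H : Finset (Piece m)) (k : ZMod m)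
    (s : Bool) :
    heapPotential (insert ⟨max (max (colHeight H (k - 1)) (colHeight H k))
      (colHeight H (k + 1)) + 1, k, s⟩ H) - heapPotential H ≤
      addBound (colHeight H) (secondHeight H) k := by
  unfold heapPotential
  rw [colHeight_insert _ _ (by simp only; omega), secondHeight_insert _ _ (by simp only; omega)]
  exact potential_put_sub_le hm _ _ k _ (by simp only; omega) (by simp only; omega)
    (by simp only; omega)

theorem heapPotential_erase_sub_le [NeZero m] (hm : 4 ≤ m) {H : Finset (Piece m)} (hH : IsHeap H)
    (p : Piece m) (hp : p ∈ H) (ht : p.height = colHeight H p.col)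
    (hk : IsPeak (colHeight H) p.col) :
    heapPotential (H.erase p) - heapPotential H ≤
      removeBound (colHeight H) (secondHeight H) p.col := by
  unfold heapPotential
  rw [colHeight_erase hH p hp ht, secondHeight_erase hH p hp ht]
  exact potential_remove_sub_le hm _ _ _ _ hk (secondHeight_le_colHeight _ _)

/-- On a roof column exactly one sign annihilates, namely the opposite of the top piece's sign;
elsewhere both signs add. -/
theorem sum_bool_heapPotential_drop_le [NeZero m] (hm : 4 ≤ m) {H : Finset (Piece m)}
    (hH : IsHeap H) (k : ZMod m) :
    ∑ s, (heapPotential (drop H (k, s)) - heapPotential H) ≤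
      if IsPeak (colHeight H) k then
        addBound (colHeight H) (secondHeight H) k + removeBound (colHeight H) (secondHeight H) k
      else 2 * addBound (colHeight H) (secondHeight H) k := by
  have hi := heapPotential_insert_sub_le hm H k
  rw [Fintype.sum_bool]
  split_ifs with hk
  · obtain ⟨p, hp, hc, ht⟩ := exists_height_eq_colHeight (H := H) (k := k) (by
      have := hk.1; omega)
    have hmax : max (colHeight H (k - 1)) (colHeight H (k + 1)) < colHeight H k :=
      max_lt hk.1 hk.2
    have he : p = ⟨colHeight H k, k, p.sign⟩ := by
      ext <;> simp [hc, ht]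
    have hrem : drop H (k, !p.sign) = H.erase p := by
      unfold drop
      simp only [Bool.not_not, ← he]
      rw [if_pos ⟨hmax, hp⟩]
    have hpush : drop H (k, p.sign) = insert ⟨max (max (colHeight H (k - 1)) (colHeight H k))
        (colHeight H (k + 1)) + 1, k, p.sign⟩ H := by
      unfold drop
      rw [if_neg]
      rintro ⟨-, hq⟩
      have := hH.inj _ hq p hp hc.symm ht.symm
      rw [he] at this
      simp at this
    have e1 := hi p.sign
    have e2 := heapPotential_erase_sub_le hm hH p hp (by rw [ht, hc]) (by rwa [hc])
    rw [← hpush] at e1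
    rw [← hrem, hc] at e2
    rcases hs : p.sign with _ | _ <;> rw [hs] at e1 e2 <;>
      simp only [Bool.not_false, Bool.not_true] at e1 e2 <;> linarith
  · have hadd : ∀ s, drop H (k, s) = insert ⟨max (max (colHeight H (k - 1)) (colHeight H k))
        (colHeight H (k + 1)) + 1, k, s⟩ H := by
      intro s
      unfold drop
      rw [if_neg]
      rintro ⟨hq, -⟩
      exact hk ⟨(le_max_left _ _).trans_lt hq, (le_max_right _ _).trans_lt hq⟩
    rw [hadd, hadd]
    linarith [hi true, hi false]

/-- The mean drift of the potential bounds the size of the roof. -/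
theorem sum_heapPotential_drop_le [NeZero m] (hm : 4 ≤ m) {H : Finset (Piece m)}
    (hH : IsHeap H) :
    ∑ x, (heapPotential (drop H x) - heapPotential H) ≤
      2 * (270 * m - 821 * (roof H).card) := by
  rw [Fintype.sum_prod_type]
  refine (Finset.sum_le_sum fun k _ => sum_bool_heapPotential_drop_le hm hH k).trans ?_
  rw [sum_bounds]
  linarith [card_roof_le hH]

theorem abs_heapPotential_le [NeZero m] (H : Finset (Piece m)) : |heapPotential H| ≤ 500 * m :=
  abs_potential_le _ _

end Heap

/-! ### A strong law for bounded martingale differences -/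

section LargeNumbers

/-- A function of finitely many coordinates factors through their restriction. -/
theorem exists_factor_of_dependsOn {α : Type*} [Nonempty α] {Y : (ℕ → α) → ℝ} {n : ℕ}
    (hY : DependsOn Y (Set.Iio n)) :
    ∃ G : (Finset.range n → α) → ℝ, ∀ x : ℕ → α, Y x = G fun i => x i := by
  classical
  inhabit α
  refine ⟨fun u => Y fun i => if h : i ∈ Finset.range n then u ⟨i, h⟩ else default, fun x => ?_⟩
  refine hY fun i hi => ?_
  simp [Set.mem_Iio.1 hi]

/-- The sum of the first `n` increments along the sequence `x`. -/
def incSum {α : Type*} (ψ : ℕ → α → (ℕ → α) → ℝ) (n : ℕ) (x : ℕ → α) : ℝ :=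
  ∑ i ∈ Finset.range n, ψ i (x i) x

theorem dependsOn_incSum {α : Type*} {ψ : ℕ → α → (ℕ → α) → ℝ}
    (hψ : ∀ n a, DependsOn (ψ n a) (Set.Iio n)) (n : ℕ) :
    DependsOn (incSum ψ n) (Set.Iio n) := by
  intro x y hxy
  refine Finset.sum_congr rfl fun i hi => ?_
  rw [Finset.mem_range] at hi
  rw [hxy i hi]
  exact hψ i _ fun j hj => hxy j (lt_trans hj hi)

theorem limsup_le_of_le_add_error {f s : ℕ → ℝ} {a b c : ℝ}
    (hs : Tendsto (fun n : ℕ => s n / n) atTop (nhds 0)) (h0 : ∀ n, 0 ≤ f n)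
    (hf : ∀ n : ℕ, 0 < n → f n ≤ a + b * (s n / n) + c / n) : limsup f atTop ≤ a := by
  have hlim : Tendsto (fun n : ℕ => a + b * (s n / n) + c / n) atTop (nhds a) := by
    have h2 := ((hs.const_mul b).const_add a).add
      (tendsto_natCast_atTop_atTop.const_div_atTop c)
    rwa [mul_zero, add_zero, add_zero] at h2
  refine (limsup_le_limsup ?_ ?_ hlim.isBoundedUnder_le).trans hlim.limsup_eq.le
  · filter_upwards [eventually_gt_atTop 0] with n hn using hf n hn
  -- Comparison of real `limsup`s needs a lower bound on `f`; nonnegativity supplies it.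
  · exact IsCoboundedUnder.of_frequently_ge (a := 0) (Frequently.of_forall h0)

variable {Ω α : Type*} [MeasurableSpace Ω] {μ : Measure Ω} [IsProbabilityMeasure μ]
  [Fintype α] [MeasurableSpace α] [DiscreteMeasurableSpace α] {ξ : ℕ → Ω → α}

theorem measurable_of_dependsOn [Nonempty α] (hmeas : ∀ n, Measurable (ξ n)) {Y : (ℕ → α) → ℝ}
    {n : ℕ} (hY : DependsOn Y (Set.Iio n)) : Measurable fun ω => Y fun i => ξ i ω := by
  obtain ⟨G, hG⟩ := exists_factor_of_dependsOn hY
  simp only [hG]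
  exact (Measurable.of_discrete (f := G)).comp (measurable_pi_lambda _ fun i => hmeas i)

theorem integrable_of_dependsOn [Nonempty α] (hmeas : ∀ n, Measurable (ξ n)) {Y : (ℕ → α) → ℝ}
    {n : ℕ} (hY : DependsOn Y (Set.Iio n)) : Integrable (fun ω => Y fun i => ξ i ω) μ := by
  obtain ⟨G, hG⟩ := exists_factor_of_dependsOn hY
  simp only [hG]
  have hU : Measurable fun ω => fun i : Finset.range n => ξ i ω :=
    measurable_pi_lambda _ fun i => hmeas i
  have := Measure.isProbabilityMeasure_map (μ := μ) hU.aemeasurable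
  exact (Integrable.of_finite (f := G)).comp_measurable hU

/-- Splitting by the value of `ξ n`, independence from the past turns the integral into `p` times
the integral of `∑ a, Y a`, which is zero. -/
theorem integral_eq_zero_of_sum_eq_zero [Nonempty α] (hmeas : ∀ n, Measurable (ξ n))
    (hindep : iIndepFun ξ μ) {p : ENNReal} (hunif : ∀ n a, μ (ξ n ⁻¹' {a}) = p) {n : ℕ}
    {Y : α → (ℕ → α) → ℝ} (hY : ∀ a, DependsOn (Y a) (Set.Iio n)) (hsum : ∀ x, ∑ a, Y a x = 0) :
    ∫ ω, Y (ξ n ω) (fun i => ξ i ω) ∂μ = 0 := by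
  classical
  have hone : Measurable fun ω => fun a : α => if ξ n ω = a then (1 : ℝ) else 0 :=
    (Measurable.of_discrete (f := fun b : α => fun a : α => if b = a then (1 : ℝ) else 0)).comp
      (hmeas n)
  have hind : ∀ a, IndepFun (fun ω => Y a fun i => ξ i ω)
      (fun ω => if ξ n ω = a then (1 : ℝ) else 0) μ := by
    intro a
    obtain ⟨G, hG⟩ := exists_factor_of_dependsOn (hY a)
    have h := hindep.indepFun_finset (Finset.range n) {n} (by simp) hmeas
    simp only [hG]
    exact h.comp (φ := G) (ψ := fun u => if u ⟨n, by simp⟩ = a then (1 : ℝ) else 0)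
      Measurable.of_discrete Measurable.of_discrete
  have hprod : ∀ a, ∫ ω, (Y a fun i => ξ i ω) * (if ξ n ω = a then (1 : ℝ) else 0) ∂μ =
      (∫ ω, (Y a fun i => ξ i ω) ∂μ) * p.toReal := by
    intro a
    have hm1 := measurable_of_dependsOn hmeas (hY a)
    have hm2 : Measurable fun ω => if ξ n ω = a then (1 : ℝ) else 0 := measurable_pi_iff.1 hone a
    rw [(hind a).integral_fun_mul_eq_mul_integral hm1.aestronglyMeasurable
      hm2.aestronglyMeasurable]
    congr 1
    have : (fun ω => if ξ n ω = a then (1 : ℝ) else 0) = (ξ n ⁻¹' {a}).indicator 1 := by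
      funext ω
      simp [Set.indicator_apply]
    rw [this, integral_indicator_one (hmeas n (measurableSet_singleton a)), measureReal_def, hunif]
  have hexp : ∀ ω, Y (ξ n ω) (fun i => ξ i ω) =
      ∑ a, (Y a fun i => ξ i ω) * (if ξ n ω = a then (1 : ℝ) else 0) := by
    intro ω
    simp
  have hint : ∀ a, Integrable (fun ω => Y a fun i => ξ i ω) μ := fun a =>
    integrable_of_dependsOn hmeas (hY a)
  simp only [hexp]
  rw [integral_finsetSum]
  · rw [Finset.sum_congr rfl fun a _ => hprod a, ← Finset.sum_mul,
      ← integral_finsetSum _ fun a _ => hint a]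
    simp [hsum]
  · intro a _
    refine (hint a).mul_bdd (c := 1) (measurable_pi_iff.1 hone a).aestronglyMeasurable ?_
    refine Eventually.of_forall fun ω => ?_
    split_ifs <;> simp

variable {ψ : ℕ → α → (ℕ → α) → ℝ} {C : ℝ}

/-- Increments are orthogonal to the past, so cross terms vanish and each step adds at most `C ^ 2`.
-/
theorem integral_incSum_sq_le [Nonempty α] (hmeas : ∀ n, Measurable (ξ n))
    (hindep : iIndepFun ξ μ) {p : ENNReal} (hunif : ∀ n a, μ (ξ n ⁻¹' {a}) = p)
    (hψ : ∀ n a, DependsOn (ψ n a) (Set.Iio n)) (hsum : ∀ n x, ∑ a, ψ n a x = 0)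
    (hC : ∀ n a x, |ψ n a x| ≤ C) (n : ℕ) :
    ∫ ω, incSum ψ n (fun i => ξ i ω) ^ 2 ∂μ ≤ C ^ 2 * n := by
  induction n with
  | zero => simp [incSum]
  | succ n ih =>
    have hS := dependsOn_incSum hψ n
    have hmono : Set.Iio n ⊆ Set.Iio (n + 1) := Set.Iio_subset_Iio (Nat.le_succ n)
    have hd : DependsOn (fun x : ℕ → α => ψ n (x n) x) (Set.Iio (n + 1)) := by
      intro x y hxy
      change ψ n (x n) x = ψ n (y n) y
      rw [hxy n (Set.mem_Iio.2 (Nat.lt_succ_self n))]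
      exact hψ n _ fun j hj => hxy j (hmono hj)
    have i1 : Integrable (fun ω => incSum ψ n (fun i => ξ i ω) ^ 2) μ :=
      integrable_of_dependsOn (Y := fun x => incSum ψ n x ^ 2) (n := n) hmeas
        fun x y hxy => by simp only [hS hxy]
    have i2 : Integrable (fun ω => 2 * (incSum ψ n (fun i => ξ i ω) *
        ψ n (ξ n ω) (fun i => ξ i ω))) μ :=
      integrable_of_dependsOn (Y := fun x => 2 * (incSum ψ n x * ψ n (x n) x)) (n := n + 1) hmeas
        fun x y hxy => by
          have h1 := hS fun j hj => hxy j (hmono hj)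
          have h2 := hd hxy
          simp only at h2
          simp only [h1, h2]
    have i3 : Integrable (fun ω => ψ n (ξ n ω) (fun i => ξ i ω) ^ 2) μ :=
      integrable_of_dependsOn (Y := fun x => ψ n (x n) x ^ 2) (n := n + 1) hmeas
        fun x y hxy => by
          have h2 := hd hxy
          simp only at h2
          simp only [h2]
    have z : ∫ ω, incSum ψ n (fun i => ξ i ω) * ψ n (ξ n ω) (fun i => ξ i ω) ∂μ = 0 :=
      integral_eq_zero_of_sum_eq_zero (Y := fun a x => incSum ψ n x * ψ n a x) hmeas hindep hunif
        (fun a x y hxy => by simp only [hS hxy, hψ n a hxy])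
        fun x => by rw [← Finset.mul_sum, hsum, mul_zero]
    have hsq : ∫ ω, ψ n (ξ n ω) (fun i => ξ i ω) ^ 2 ∂μ ≤ C ^ 2 := by
      refine (integral_mono i3 (integrable_const (C ^ 2)) fun ω => ?_).trans (by simp)
      exact sq_le_sq' (abs_le.1 (hC _ _ _)).1 (abs_le.1 (hC _ _ _)).2
    have hexp : ∀ ω, incSum ψ (n + 1) (fun i => ξ i ω) ^ 2 =
        incSum ψ n (fun i => ξ i ω) ^ 2 +
          2 * (incSum ψ n (fun i => ξ i ω) * ψ n (ξ n ω) (fun i => ξ i ω)) +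
          ψ n (ξ n ω) (fun i => ξ i ω) ^ 2 := by
      intro ω
      rw [incSum, Finset.sum_range_succ, ← incSum]
      ring
    simp only [hexp]
    have i12 : Integrable (fun ω => incSum ψ n (fun i => ξ i ω) ^ 2 +
        2 * (incSum ψ n (fun i => ξ i ω) * ψ n (ξ n ω) (fun i => ξ i ω))) μ := i1.add i2
    rw [integral_add i12 i3, integral_add i1 i2, integral_const_mul, z]
    push_cast
    linarith

/-- Strong law of large numbers for bounded martingale differences of a uniform sequence. -/
theorem ae_tendsto_incSum_div [Nonempty α] (hmeas : ∀ n, Measurable (ξ n))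
    (hindep : iIndepFun ξ μ) {p : ENNReal} (hunif : ∀ n a, μ (ξ n ⁻¹' {a}) = p)
    (hψ : ∀ n a, DependsOn (ψ n a) (Set.Iio n)) (hsum : ∀ n x, ∑ a, ψ n a x = 0)
    (hC : ∀ n a x, |ψ n a x| ≤ C) :
    ∀ᵐ ω ∂μ, Tendsto (fun n : ℕ => incSum ψ n (fun i => ξ i ω) / n) atTop (nhds 0) := by
  -- Along the squares the second moments are `O(1 / n ^ 2)`, hence summable, which gives almost
  -- sure convergence on that subsequence.
  set Z : ℕ → Ω → ℝ := fun n ω =>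
    (incSum ψ ((n + 1) ^ 2) (fun i => ξ i ω) / ((n + 1 : ℝ)) ^ 2) ^ 2 with hZ
  have hSm : ∀ n, Measurable fun ω => incSum ψ n (fun i => ξ i ω) := fun n =>
    measurable_of_dependsOn hmeas (dependsOn_incSum hψ n)
  have hZm : ∀ n, Measurable (Z n) := fun n => ((hSm _).div_const _).pow_const 2
  have hZi : ∀ n, Integrable (Z n) μ := fun n =>
    integrable_of_dependsOn (Y := fun x => (incSum ψ ((n + 1) ^ 2) x / ((n + 1 : ℝ)) ^ 2) ^ 2)
      (n := (n + 1) ^ 2) hmeas fun x y hxy => by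
        simp only [dependsOn_incSum hψ _ hxy]
  have hZb : ∀ n, ∫ ω, Z n ω ∂μ ≤ C ^ 2 * (1 / ((n : ℝ) + 1) ^ 2) := by
    intro n
    have h := integral_incSum_sq_le hmeas hindep hunif hψ hsum hC ((n + 1) ^ 2)
    simp only [hZ, div_pow, integral_div]
    have hpos : (0 : ℝ) < ((n : ℝ) + 1) ^ 2 := by positivity
    rw [div_le_iff₀ (by positivity)]
    refine h.trans (le_of_eq ?_)
    push_cast
    field_simp
  have hsummable : Summable fun n : ℕ => C ^ 2 * (1 / ((n : ℝ) + 1) ^ 2) := by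
    refine Summable.mul_left _ ?_
    have := (summable_nat_add_iff 1).2 (Real.summable_one_div_nat_pow.2 one_lt_two)
    simpa using this
  have hfin : ∫⁻ ω, ∑' n, ENNReal.ofReal (Z n ω) ∂μ ≠ ⊤ := by
    rw [lintegral_tsum fun n => (hZm n).ennreal_ofReal.aemeasurable]
    have hle : ∀ n, ∫⁻ ω, ENNReal.ofReal (Z n ω) ∂μ ≤
        ENNReal.ofReal (C ^ 2 * (1 / ((n : ℝ) + 1) ^ 2)) := fun n => by
      rw [← ofReal_integral_eq_lintegral_ofReal (hZi n)
        (Eventually.of_forall fun ω => sq_nonneg _)]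
      exact ENNReal.ofReal_le_ofReal (hZb n)
    refine ne_top_of_le_ne_top ?_ (ENNReal.tsum_le_tsum hle)
    rw [← ENNReal.ofReal_tsum_of_nonneg (fun n => by positivity) hsummable]
    exact ENNReal.ofReal_ne_top
  have hae := ae_lt_top (Measurable.tsum fun n => (hZm n).ennreal_ofReal) hfin
  filter_upwards [hae] with ω hω
  have hC0 : 0 ≤ C := (abs_nonneg _).trans (hC 0 (ξ 0 ω) fun i => ξ i ω)
  have hZ0 : Tendsto (fun n => Z n ω) atTop (nhds 0) := by
    have h := ENNReal.tendsto_atTop_zero_of_tsum_ne_top hω.ne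
    have h' := (ENNReal.tendsto_toReal ENNReal.zero_ne_top).comp h
    refine h'.congr fun n => ?_
    exact ENNReal.toReal_ofReal (sq_nonneg _)
  set S : ℕ → ℝ := fun n => incSum ψ n (fun i => ξ i ω) with hS
  have hsub : Tendsto (fun n : ℕ => S ((n + 1) ^ 2) / ((n + 1 : ℝ)) ^ 2) atTop (nhds 0) := by
    have h := hZ0.sqrt
    simp only [hZ, Real.sqrt_sq_eq_abs, Real.sqrt_zero] at h
    exact (tendsto_zero_iff_abs_tendsto_zero _).2 h
  -- Increments are at least `-C`, so the added drift makes the sums monotone and allows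
  -- interpolation between squares, whose successive ratios tend to 1.
  have hmono : Monotone fun n : ℕ => S n + C * n := by
    refine monotone_nat_of_le_succ fun n => ?_
    have h1 := (abs_le.1 (hC n (ξ n ω) fun i => ξ i ω)).1
    have h2 : S (n + 1) = S n + ψ n (ξ n ω) (fun i => ξ i ω) := by
      simp only [hS, incSum, Finset.sum_range_succ]
    push_cast
    linarith
  have hsq : Tendsto (fun n : ℕ => (n + 1) ^ 2) atTop atTop :=
    (tendsto_pow_atTop two_ne_zero).comp (tendsto_add_atTop_nat 1)
  have main := tendsto_div_of_monotone_of_exists_subseq_tendsto_div (fun n : ℕ => S n + C * n) C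
    hmono fun a ha => ⟨fun n => (n + 1) ^ 2, ?_, hsq, ?_⟩
  · have := main.sub_const C
    rw [sub_self] at this
    refine this.congr' ?_
    filter_upwards [eventually_gt_atTop 0] with n hn
    have hn' : (n : ℝ) ≠ 0 := by exact_mod_cast hn.ne'
    field_simp
    ring
  · have hlim : Tendsto (fun n : ℕ => (1 + 1 / ((n : ℝ) + 1)) ^ 2) atTop (nhds 1) := by
      have := (tendsto_one_div_add_atTop_nhds_zero_nat (𝕜 := ℝ)).const_add 1
      simpa using this.pow 2
    filter_upwards [hlim.eventually_lt_const ha] with n hn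
    have hpos : (0 : ℝ) < (n : ℝ) + 1 := by positivity
    have hid : ((n : ℝ) + 1 + 1) ^ 2 = (1 + 1 / ((n : ℝ) + 1)) ^ 2 * ((n : ℝ) + 1) ^ 2 := by
      field_simp
    push_cast
    rw [hid]
    exact mul_le_mul_of_nonneg_right hn.le (by positivity)
  · have := hsub.add_const C
    rw [zero_add] at this
    refine this.congr fun n => ?_
    have hpos : (0 : ℝ) < (n : ℝ) + 1 := by positivity
    push_cast
    field_simp

end LargeNumbers

/-! ### Drift and fluctuation along the random heap -/

theorem dependsOn_heapProcess {m : ℕ} (n : ℕ) :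
    DependsOn (fun x : ℕ → ZMod m × Bool => heapProcess x n) (Set.Iio n) := by
  induction n with
  | zero => exact fun x y _ => rfl
  | succ n ih =>
    intro x y hxy
    have h1 := ih fun i hi => hxy i (Set.mem_Iio.2 ((Set.mem_Iio.1 hi).trans (Nat.lt_succ_self n)))
    simp only at h1
    simp only [heapProcess, h1, hxy n (Set.mem_Iio.2 (Nat.lt_succ_self n))]

/-- The fluctuation of the heap potential at time `n`, for the drop `a`. -/
def fluctuation {m : ℕ} [NeZero m] (n : ℕ) (a : ZMod m × Bool) (x : ℕ → ZMod m × Bool) : ℝ :=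
  2 * m * (heapPotential (drop (heapProcess x n) a) : ℝ) -
    ∑ b, (heapPotential (drop (heapProcess x n) b) : ℝ)

theorem card_drops (m : ℕ) [NeZero m] : (Fintype.card (ZMod m × Bool) : ℝ) = 2 * m := by
  simp [ZMod.card, mul_comm]

/-- The drift bound is summed along one trajectory. Everything is multiplied by the number `2 * m`
of drops, so averages become sums. -/
theorem sum_roof_le {m : ℕ} [NeZero m] (hm : 4 ≤ m) (x : ℕ → ZMod m × Bool) (n : ℕ) :
    2 * 821 * ∑ k ∈ Finset.range n, ((roof (heapProcess x k)).card : ℝ) ≤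
      2 * 270 * m * n + incSum fluctuation n x +
        2 * m * (heapPotential (heapProcess x 0) - heapPotential (heapProcess x n)) := by
  induction n with
  | zero => simp [incSum]
  | succ n ih =>
    have h := sum_heapPotential_drop_le hm (isHeap_heapProcess hm x n)
    rw [Finset.sum_sub_distrib, Finset.sum_const, Finset.card_univ, nsmul_eq_mul] at h
    have h' : (∑ b, (heapPotential (drop (heapProcess x n) b) : ℝ)) -
        (Fintype.card (ZMod m × Bool) : ℝ) * heapPotential (heapProcess x n) ≤
        2 * (270 * m - 821 * (roof (heapProcess x n)).card) := by
      exact_mod_cast h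
    rw [card_drops] at h'
    rw [Finset.sum_range_succ, incSum, Finset.sum_range_succ, ← incSum]
    simp only [fluctuation, heapProcess] at ih ⊢
    push_cast
    linarith

theorem abs_heapPotential_cast_le {m : ℕ} [NeZero m] (H : Finset (Piece m)) :
    |(heapPotential H : ℝ)| ≤ 500 * m := by
  exact_mod_cast abs_heapPotential_le H

theorem roof_average_le {m : ℕ} [NeZero m] (hm : 4 ≤ m) (x : ℕ → ZMod m × Bool) {n : ℕ}
    (hn : 0 < n) :
    1 / ((m : ℝ) * (n : ℝ)) * ∑ k ∈ Finset.Icc 1 n, ((roof (heapProcess x k)).card : ℝ) ≤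
      270 / 821 + 1 / (2 * 821 * m) * (incSum fluctuation n x / n) +
        (1000 / 821 + 1) * m / n := by
  have hm0 : (0 : ℝ) < m := by exact_mod_cast (by omega : 0 < m)
  have hn' : (0 : ℝ) < n := by exact_mod_cast hn
  have h1 := sum_roof_le hm x n
  -- Passing from times `0, …, n - 1` to `1, …, n` costs at most one roof, of size at most `m`.
  have h2 : ∑ k ∈ Finset.Icc 1 n, ((roof (heapProcess x k)).card : ℝ) ≤
      ∑ k ∈ Finset.range n, ((roof (heapProcess x k)).card : ℝ) + m := by
    have hsub : Finset.Icc 1 n ⊆ Finset.range (n + 1) := fun k hk => by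
      simp only [Finset.mem_Icc, Finset.mem_range] at hk ⊢; omega
    refine (Finset.sum_le_sum_of_subset_of_nonneg hsub fun _ _ _ => by positivity).trans ?_
    rw [Finset.sum_range_succ]
    have hr : ((roof (heapProcess x n)).card : ℤ) ≤ m := by
      refine (card_roof_le (isHeap_heapProcess hm x n)).trans ?_
      refine (Finset.sum_le_sum fun k _ => ind_le_one _).trans ?_
      simp [ZMod.card]
    have hr' : ((roof (heapProcess x n)).card : ℝ) ≤ m := by
      exact_mod_cast hr
    linarith
  have h3 := abs_le.1 (abs_heapPotential_cast_le (heapProcess x 0))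
  have h4 := abs_le.1 (abs_heapPotential_cast_le (heapProcess x n))
  have h5 : 2 * m * ((heapPotential (heapProcess x 0) : ℝ) -
      heapPotential (heapProcess x n)) ≤ 2 * m * (1000 * m) :=
    mul_le_mul_of_nonneg_left (by linarith [h3.2, h4.1]) (by positivity)
  rw [one_div, inv_mul_le_iff₀ (by positivity)]
  have key : (m : ℝ) * n * (270 / 821 + 1 / (2 * 821 * m) *
      (incSum fluctuation n x / n) + (1000 / 821 + 1) * m / n) =
      270 / 821 * m * n + incSum fluctuation n x / (2 * 821) +
        (1000 / 821 + 1) * m * m := by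
    field_simp
  rw [key]
  have hmm : (m : ℝ) ≤ m * m := by
    have : (1 : ℝ) ≤ m := by exact_mod_cast (by omega : 1 ≤ m)
    nlinarith
  linarith

end RandomHeap

theorem mainTheorem2 {Ω : Type*} [MeasurableSpace Ω] (μ : Measure Ω) [IsProbabilityMeasure μ]
    (m : ℕ) (hm : 4 ≤ m)
    (ξ : ℕ → Ω → ZMod m × Bool)
    (hmeas : ∀ n, Measurable (ξ n))
    (hindep : iIndepFun ξ μ)
    (hunif : ∀ n x, μ (ξ n ⁻¹' {x}) = (2 * (m : ENNReal))⁻¹) :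
    ∀ᵐ ω ∂μ,
      limsup (fun n : ℕ => 1 / ((m : ℝ) * (n : ℝ)) *
        ∑ k ∈ Finset.Icc 1 n,
          ((RandomHeap.roof (RandomHeap.heapProcess (fun i => ξ i ω) k)).card : ℝ)) atTop
        ≤ (0.32893 : ℝ) := by
  have : NeZero m := ⟨by omega⟩
  have hm0 : (0 : ℝ) < m := by exact_mod_cast (by omega : 0 < m)
  have hdep : ∀ n (a : ZMod m × Bool), DependsOn (RandomHeap.fluctuation n a) (Set.Iio n) := by
    intro n a x y hxy
    have h := RandomHeap.dependsOn_heapProcess n hxy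
    simp only at h
    simp only [RandomHeap.fluctuation, h]
  have hsum : ∀ n (x : ℕ → ZMod m × Bool), ∑ a, RandomHeap.fluctuation n a x = 0 := by
    intro n x
    simp only [RandomHeap.fluctuation]
    rw [Finset.sum_sub_distrib, Finset.sum_const, Finset.card_univ, nsmul_eq_mul,
      RandomHeap.card_drops, ← Finset.mul_sum, sub_self]
  have hbd : ∀ n (a : ZMod m × Bool) x,
      |RandomHeap.fluctuation n a x| ≤ 2 * m * (500 * m) + 2 * m * (500 * m) := by
    intro n a x
    refine (abs_sub _ _).trans (add_le_add ?_ ?_)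
    · rw [abs_mul, abs_of_pos (by positivity : (0 : ℝ) < 2 * m)]
      exact mul_le_mul_of_nonneg_left (RandomHeap.abs_heapPotential_cast_le _) (by positivity)
    · refine (Finset.abs_sum_le_sum_abs _ _).trans ?_
      refine (Finset.sum_le_sum fun b _ => RandomHeap.abs_heapPotential_cast_le _).trans ?_
      rw [Finset.sum_const, Finset.card_univ, nsmul_eq_mul, RandomHeap.card_drops]
  filter_upwards [RandomHeap.ae_tendsto_incSum_div hmeas hindep hunif hdep hsum hbd] with ω hω
  refine (RandomHeap.limsup_le_of_le_add_error hω
    (fun n => mul_nonneg (one_div_nonneg.2 (by positivity))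
      (Finset.sum_nonneg fun _ _ => Nat.cast_nonneg _))
    (fun n hn => RandomHeap.roof_average_le hm (fun i => ξ i ω) hn)).trans ?_
  -- The remaining comparison is 270/821 ≤ 0.32893.
  norm_num
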